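/- A reduced crossed complex $(C,\partial)$ is a sequence of groups $\cdots\to C_3\xrightarrow{\partial_3}C_2\xrightarrow{\partial_2}C_1$ with $\partial\partial=1$ and a right action of $C_1$ on every $C_k$ (by conjugation on $C_1$), such that the boundaries are $C_1$-equivariant, $C_k$ is abelian for $k\ge 3$, $y^{\partial_2x}=x^{-1}yx$ for $x,y\in C_2$, and $\partial_2(C_2)$ acts trivially on $C_k$ for $k\ge 3$; put $C_0=1$. It is a reduced $N$-crossed complex ($N\le\infty$) if $C_k=1$ for all $k>N$. A morphism is a family of homomorphisms compatible with boundaries and actions. It is a weak equivalence if it induces isomorphisms on all $\pi_k(C)=\ker\partial_k/\operatorname{im}\partial_{k+1}$, $k\ge1$; a trivial fibration if it is a weak equivalence that is surjective in every degree. A reduced $N$-crossed complex $Q$ is cofibrant if $\ast\to Q$ has the left lifting property with respect to all trivial fibrations between reduced $N$-crossed complexes; a cofibrant replacement of $H$ is a trivial fibration $p:Q\to H$ with $Q$ cofibrant. Let $n\ge2$ and let $(H,\partial)$, $(G,\delta)$ be reduced $n$-crossed complexes. An $n$-butterfly $((E,\eta),p,f,\alpha,\beta)$ from $H$ to $G$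 consists of a reduced $(n-1)$-crossed complex $E$, morphisms $p:E\to H_{\le n-1}$, $f:E\to G_{\le n-1}$, and homomorphisms $\alpha:H_n\to E_{n-1}$, $\beta:G_n\to E_{n-1}$ with $p_{n-1}\alpha=\partial_n$, $f_{n-1}\beta=\delta_n$, such that * with $u_k=(\eta_k,p_k):E_k\to\ker\eta_{k-1}\times_{\ker\partial_{k-1}}H_k$, the sequence $1\to G_n\xrightarrow{\beta}E_{n-1}\xrightarrow{u_{n-1}}\ker\eta_{n-2}\times_{\ker\partial_{n-2}}H_{n-1}\to1$ is exact and $u_k$ is surjective for $1\le k\le n-2$; * $\eta_{n-1}(\alpha(x)\beta(y))=1$ and $f_{n-1}(\alpha(x))=1$ for all $x\in H_n$, $y\in G_n$; * $\alpha(x^{p_1(a)})=\alpha(x)^a$ and $\beta(y^{f_1(a)})=\beta(y)^a$ for $x\in H_n$, $y\in G_n$, $a\in E_1$. Let $E^*$ be the reduced $n$-crossed complex $H_n\times G_n\xrightarrow{(x,y)\mapsto\alpha(x)\beta(y)}E_{n-1}\xrightarrow{\eta_{n-1}}\cdots\to E_1$, where $E_1$ acts on $H_n\times G_n$ through $p_1$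 and $f_1$, and let $p^*:E^*\to H$ be the morphism given by the projection $H_n\times G_n\to H_n$ in degree $n$ and by $p$ in lower degrees. **Corollary.** Let $((E,\eta),p,f,\alpha,\beta)$ be an $n$-butterfly from $H$ to $G$, and let $p_Q:Q\to H$ be a cofibrant replacement of $H$ in the category of reduced $n$-crossed complexes (or, more generally, in the category of reduced $N$-crossed complexes for some $n\le N\le\infty$, where $N=\infty$ means all reduced crossed complexes). Then $p^*$ is a trivial fibration, and there exists a weak equivalence $l:Q\to E^*$ such that $p^*\circ l=p_Q$. -/

import Mathlib

open CategoryTheory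

universe u

/-- A reduced crossed complex `⋯ → X 3 → X 2 → X 1`: a crossed complex of groups.
The group `X 1` acts on the right on every `X k`; on `X 1` itself it acts by conjugation.
The degree `0` group is trivial, so that `d 0 : X 1 → X 0` is the trivial map. -/
structure ReducedCrossedComplex : Type (u + 1) where
  X : ℕ → Type u
  [grp : ∀ k, Group (X k)]
  /-- The boundary map from degree `k + 1` to degree `k`. -/
  d : ∀ k, X (k + 1) →* X k
  /-- The right action `x ^ a` of `a` in degree `1` on `x` in degree `k`. -/
  act : ∀ k, X k → X 1 → X k
  zero_subsingleton : Subsingleton (X 0)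
  act_one : ∀ k (x : X k), act k x 1 = x
  act_mul : ∀ k (x : X k) (a b : X 1), act k x (a * b) = act k (act k x a) b
  mul_act : ∀ k (x y : X k) (a : X 1), act k (x * y) a = act k x a * act k y a
  act_conj : ∀ x a : X 1, act 1 x a = a⁻¹ * x * a
  mul_comm_of_three_le : ∀ k, 3 ≤ k → ∀ x y : X k, x * y = y * x
  d_act : ∀ k (x : X (k + 1)) (a : X 1), d k (act (k + 1) x a) = act k (d k x) a
  d_d : ∀ k (x : X (k + 2)), d k (d (k + 1) x) = 1
  peiffer : ∀ x y : X 2, act 2 y (d 1 x) = x⁻¹ * y * x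
  act_boundary : ∀ k, 3 ≤ k → ∀ (x : X 2) (y : X k), act k y (d 1 x) = y

namespace ReducedCrossedComplex

attribute [instance] ReducedCrossedComplex.grp

/-- A morphism of reduced crossed complexes. -/
@[ext]
structure Hom (C D : ReducedCrossedComplex.{u}) : Type u where
  f : ∀ k, C.X k →* D.X k
  f_d : ∀ k (x : C.X (k + 1)), f k (C.d k x) = D.d k (f (k + 1) x)
  f_act : ∀ k (x : C.X k) (a : C.X 1), f k (C.act k x a) = D.act k (f k x) (f 1 a)

/-- The category of reduced crossed complexes. -/
instance : Category ReducedCrossedComplex.{u} where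
  Hom := Hom
  id C :=
    { f := fun _ => MonoidHom.id _
      f_d := fun _ _ => rfl
      f_act := fun _ _ _ => rfl }
  comp φ ψ :=
    { f := fun k => (ψ.f k).comp (φ.f k)
      f_d := fun k x => by simp [φ.f_d, ψ.f_d]
      f_act := fun k x a => by simp [φ.f_act, ψ.f_act] }

/-- `C` is a reduced `n`-crossed complex: it is trivial in all degrees above `n`.
For `n = ⊤` this is no condition. -/
def IsNCrossed (n : ℕ∞) (C : ReducedCrossedComplex.{u}) : Prop :=
  ∀ k : ℕ, n < (k : ℕ∞) → Subsingleton (C.X k)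

/-- The trivial reduced crossed complex, the initial object `*`. -/
def point : ReducedCrossedComplex.{u} where
  X _ := PUnit
  d _ := 1
  act _ x _ := x
  zero_subsingleton := inferInstance
  act_one _ _ := rfl
  act_mul _ _ _ _ := rfl
  mul_act _ _ _ _ := rfl
  act_conj _ _ := rfl
  mul_comm_of_three_le _ _ _ _ := rfl
  d_act _ _ _ := rfl
  d_d _ _ := rfl
  peiffer _ _ := rfl
  act_boundary _ _ _ _ := rfl

lemma one_act (C : ReducedCrossedComplex.{u}) (k : ℕ) (a : C.X 1) : C.act k 1 a = 1 := by
  have h := C.mul_act k 1 1 a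
  rw [mul_one] at h
  exact left_eq_mul.mp h

/-- The unique morphism `* ⟶ C`. -/
def fromPoint (C : ReducedCrossedComplex.{u}) : point ⟶ C where
  f _ := 1
  f_d _ _ := by simp
  f_act _ _ _ := by simp [one_act]

/-- The cycles of `C` in degree `k`, the kernel of the boundary out of degree `k`
(everything, for `k = 0`). -/
def cycles (C : ReducedCrossedComplex.{u}) : ∀ k, Subgroup (C.X k)
  | 0 => ⊤
  | k + 1 => (C.d k).ker

/-- The boundaries in degree `k + 1`, as a subgroup of the cycles. -/
def boundaries (C : ReducedCrossedComplex.{u}) (k : ℕ) : Subgroup (C.cycles (k + 1)) :=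
  (C.d (k + 1)).range.subgroupOf (C.cycles (k + 1))

instance (C : ReducedCrossedComplex.{u}) (k : ℕ) : (C.boundaries k).Normal := by
  constructor
  rintro ⟨z, hz⟩ ⟨y, hy⟩ ⟨g, hg⟩
  have hy' : C.d (k + 1) y = z := hy
  change g * z * g⁻¹ ∈ (C.d (k + 1)).range
  match k with
  | 0 =>
    refine ⟨C.act 2 y g⁻¹, ?_⟩
    have h1 := C.d_act 1 y g⁻¹
    have h2 := C.act_conj z g⁻¹
    simp only [inv_inv] at h2
    rw [← h2, ← hy']
    exact h1
  | 1 =>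
    refine ⟨y, ?_⟩
    have h1 := C.peiffer z g
    have h3 : C.d 1 z = 1 := hz
    rw [h3, C.act_one] at h1
    have h4 : z * g = g * z := by
      calc z * g = z * (z⁻¹ * g * z) := by rw [← h1]
        _ = g * z := by group
    rw [hy', ← h4]
    simp
  | k + 2 =>
    refine ⟨y, ?_⟩
    rw [hy', C.mul_comm_of_three_le (k + 2 + 1) (by omega) g z]
    simp

/-- The homotopy (homology) group of `C` in degree `k + 1`. -/
abbrev homotopyGroup (C : ReducedCrossedComplex.{u}) (k : ℕ) : Type u :=
  C.cycles (k + 1) ⧸ C.boundaries k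

/-- The map on cycles in degree `k + 1` induced by a morphism. -/
def cyclesMap {C D : ReducedCrossedComplex.{u}} (φ : C ⟶ D) (k : ℕ) :
    C.cycles (k + 1) →* D.cycles (k + 1) :=
  ((φ.f (k + 1)).comp (C.cycles (k + 1)).subtype).codRestrict (D.cycles (k + 1)) (by
    rintro ⟨x, hx⟩
    change D.d k (φ.f (k + 1) x) = 1
    rw [← φ.f_d, show C.d k x = 1 from hx, map_one])

/-- The map on homotopy groups in degree `k + 1` induced by a morphism. -/
def homotopyMap {C D : ReducedCrossedComplex.{u}} (φ : C ⟶ D) (k : ℕ) :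
    C.homotopyGroup k →* D.homotopyGroup k :=
  QuotientGroup.map _ _ (cyclesMap φ k) (by
    rintro ⟨x, hx⟩ ⟨y, hy⟩
    exact ⟨φ.f (k + 2) y, (φ.f_d (k + 1) y).symm.trans (congrArg (φ.f (k + 1)) hy)⟩)

/-- Weak equivalences: the morphisms that induce isomorphisms on all homotopy groups. -/
def weakEquivalences : MorphismProperty ReducedCrossedComplex.{u} :=
  fun _ _ φ => ∀ k, Function.Bijective (homotopyMap φ k)

/-- Fibrations: the morphisms that are surjective in every degree. -/
def fibrations : MorphismProperty ReducedCrossedComplex.{u} :=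
  fun _ _ φ => ∀ k, Function.Surjective (φ.f k)

/-- Trivial fibrations. -/
def trivialFibrations : MorphismProperty ReducedCrossedComplex.{u} :=
  fibrations ⊓ weakEquivalences

/-- The trivial fibrations between reduced `N`-crossed complexes. -/
def trivialFibrationsIn (N : ℕ∞) : MorphismProperty ReducedCrossedComplex.{u} :=
  fun C D φ => C.IsNCrossed N ∧ D.IsNCrossed N ∧ trivialFibrations φ

/-- `Q` is a cofibrant object of the category of reduced `N`-crossed complexes (of all reduced
crossed complexes, for `N = ⊤`): `* ⟶ Q` is a cofibration, that is, it has the left lifting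
property with respect to all trivial fibrations of that category. -/
def IsCofibrantIn (N : ℕ∞) (Q : ReducedCrossedComplex.{u}) : Prop :=
  Q.IsNCrossed N ∧ (trivialFibrationsIn N).llp Q.fromPoint

/-- The fibre product `ker η_k ×_{ker ∂_k} H_{k+1}` of a morphism `p` from `(E, η)` to `(H, ∂)`,
where `ker η_0` and `ker ∂_0` are trivial. -/
def fiberProd {E H : ReducedCrossedComplex.{u}} (p : E ⟶ H) (k : ℕ) :
    Subgroup (E.X k × H.X (k + 1)) where
  carrier := {x | x.1 ∈ E.cycles k ∧ p.f k x.1 = H.d k x.2}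
  one_mem' := ⟨one_mem _, by simp⟩
  mul_mem' := by
    rintro x y ⟨h1, h2⟩ ⟨h3, h4⟩
    exact ⟨mul_mem h1 h3, by simp [h2, h4]⟩
  inv_mem' := by
    rintro x ⟨h1, h2⟩
    exact ⟨inv_mem h1, by simp [h2]⟩

/-- The induced map `u_{k+1} = (η_{k+1}, p_{k+1})` from `E_{k+1}` to
`ker η_k ×_{ker ∂_k} H_{k+1}`. -/
def toFiberProd {E H : ReducedCrossedComplex.{u}} (p : E ⟶ H) (k : ℕ) :
    E.X (k + 1) →* fiberProd p k :=
  ((E.d k).prod (p.f (k + 1))).codRestrict (fiberProd p k) (by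
    intro x
    refine ⟨?_, p.f_d k x⟩
    match k with
    | 0 => exact Subgroup.mem_top _
    | k + 1 => exact E.d_d k x)

end ReducedCrossedComplex

open ReducedCrossedComplex

/-- An `n`-butterfly from `H` to `G`, where `n = m + 2`. The middle object `E` is a reduced
`(n-1)`-crossed complex. As `E` is trivial in degrees `≥ n`, morphisms from `E` to the truncation
of `H` in degrees `≤ n - 1` are the same as morphisms from `E` to `H`; likewise for `G`. -/
structure Butterfly (m : ℕ) (H G : ReducedCrossedComplex.{u}) : Type (u + 1) where
  E : ReducedCrossedComplex.{u}
  isNCrossed : E.IsNCrossed ((m + 1 : ℕ) : ℕ∞)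
  p : E ⟶ H
  f : E ⟶ G
  α : H.X (m + 2) →* E.X (m + 1)
  β : G.X (m + 2) →* E.X (m + 1)
  /-- Commutativity of the diagram. -/
  p_α : ∀ x, p.f (m + 1) (α x) = H.d (m + 1) x
  f_β : ∀ y, f.f (m + 1) (β y) = G.d (m + 1) y
  /-- Exactness of `1 → G_n → E_{n-1} → ker η_{n-2} ×_{ker ∂_{n-2}} H_{n-1} → 1`. -/
  β_injective : Function.Injective β
  range_β : β.range = (toFiberProd p m).ker
  u_top_surjective : Function.Surjective (toFiberProd p m)
  /-- Exactness of `E_k → ker η_{k-1} ×_{ker ∂_{k-1}} H_k → 1` for `k = j + 1 ≤ n - 2`. -/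
  u_surjective : ∀ j, j + 1 ≤ m → Function.Surjective (toFiberProd p j)
  /-- The compositions `η_{n-1} ∘ (α × β)` and `f_{n-1} ∘ α` are trivial. -/
  d_α_mul_β : ∀ x y, E.d m (α x * β y) = 1
  f_α : ∀ x, f.f (m + 1) (α x) = 1
  /-- Compatibility of `α` and `β` with the actions. -/
  α_act : ∀ (x : H.X (m + 2)) (a : E.X 1),
    α (H.act (m + 2) x (p.f 1 a)) = E.act (m + 1) (α x) a
  β_act : ∀ (y : G.X (m + 2)) (a : E.X 1),
    β (G.act (m + 2) y (f.f 1 a)) = E.act (m + 1) (β y) a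

namespace Butterfly

variable {m : ℕ} {H G : ReducedCrossedComplex.{u}} (B : Butterfly m H G)

lemma subsingleton_E (k : ℕ) (hk : m + 2 ≤ k) : Subsingleton (B.E.X k) :=
  B.isNCrossed k (by exact_mod_cast hk)

lemma E_eq_one (k : ℕ) (hk : m + 2 ≤ k) (x : B.E.X k) : x = 1 :=
  (B.subsingleton_E k hk).elim _ _

lemma p_β (y : G.X (m + 2)) : B.p.f (m + 1) (B.β y) = 1 := by
  have h : B.β y ∈ (toFiberProd B.p m).ker := B.range_β ▸ ⟨y, rfl⟩
  exact congrArg (fun z => z.1.2) (MonoidHom.mem_ker.mp h)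

lemma d_α (x : H.X (m + 2)) : B.E.d m (B.α x) = 1 := by
  simpa using B.d_α_mul_β x 1

lemma d_β (y : G.X (m + 2)) : B.E.d m (B.β y) = 1 := by
  simpa using B.d_α_mul_β 1 y

lemma commute_α_β (x : H.X (m + 2)) (y : G.X (m + 2)) : Commute (B.α x) (B.β y) := by
  rcases m with _ | _ | m
  · have h1 := B.β_act y (B.α x)
    have h2 : B.f.f 1 (B.α x) = 1 := B.f_α x
    rw [h2, G.act_one] at h1
    have h3 := h1.trans (B.E.act_conj (B.β y) (B.α x))
    change B.α x * B.β y = B.β y * B.α x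
    calc B.α x * B.β y = B.α x * ((B.α x)⁻¹ * B.β y * B.α x) := congrArg _ h3
      _ = B.β y * B.α x := by group
  · have h1 := B.E.peiffer (B.α x) (B.β y)
    have h2 : B.E.d 1 (B.α x) = 1 := B.d_α x
    rw [h2, B.E.act_one] at h1
    change B.α x * B.β y = B.β y * B.α x
    calc B.α x * B.β y = B.α x * ((B.α x)⁻¹ * B.β y * B.α x) := congrArg _ h1
      _ = B.β y * B.α x := by group
  · exact B.E.mul_comm_of_three_le _ (by omega) _ _

/-- The homomorphism `α × β` from `H_n × G_n` to `E_{n-1}`, sending `(x, y)` to `α x * β y`. -/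
def αβ : H.X (m + 2) × G.X (m + 2) →* B.E.X (m + 1) :=
  B.α.noncommCoprod B.β B.commute_α_β

/-- The group of the folded complex in degree `k`: the triples `(e, x, y)` in `E_k × H_k × G_k`
with `x = 1` and `y = 1` unless `k = n`. As `E_k` is trivial for `k ≥ n`, this is `E_k` for
`k < n`, it is `H_n × G_n` for `k = n`, and it is trivial for `k > n`. -/
def starSubgroup (k : ℕ) : Subgroup (B.E.X k × H.X k × G.X k) where
  carrier := {x | k ≠ m + 2 → x.2 = 1}
  one_mem' _ := rfl
  mul_mem' hx hy h := by simp [hx h, hy h]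
  inv_mem' hx h := by simp [hx h]

/-- The boundary of the folded complex, with values in `E_k`: it is `α × β` from degree `n` to
degree `n - 1`, and the boundary of `E` in all other degrees. -/
def starBoundary (k : ℕ) : B.starSubgroup (k + 1) →* B.E.X k :=
  if hk : k = m + 1 then
    (show B.starSubgroup (k + 1) →* B.E.X k by
      subst hk
      exact B.αβ.comp ((MonoidHom.snd _ _).comp (B.starSubgroup (m + 2)).subtype))
  else (B.E.d k).comp ((MonoidHom.fst _ _).comp (B.starSubgroup (k + 1)).subtype)

lemma starBoundary_top (z : B.starSubgroup (m + 2)) :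
    B.starBoundary (m + 1) z = B.α z.1.2.1 * B.β z.1.2.2 := by
  simp [starBoundary, αβ]

lemma starBoundary_of_ne (k : ℕ) (hk : k ≠ m + 1) (z : B.starSubgroup (k + 1)) :
    B.starBoundary k z = B.E.d k z.1.1 := by
  simp [starBoundary, hk]

/-- The inclusion of `E_k` in degree `k` of the folded complex. -/
def starIncl (k : ℕ) : B.E.X k →* B.starSubgroup k :=
  (MonoidHom.inl _ _).codRestrict (B.starSubgroup k) (fun _ _ => rfl)

/-- The action of `E_1` on the folded complex: in degree `n` it acts on `H_n` through `p_1` and on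
`G_n` through `f_1`. -/
def starAct (k : ℕ) (z : B.starSubgroup k) (a : B.starSubgroup 1) : B.starSubgroup k :=
  ⟨(B.E.act k z.1.1 a.1.1, H.act k z.1.2.1 (B.p.f 1 a.1.1), G.act k z.1.2.2 (B.f.f 1 a.1.1)), by
    intro hk
    have h := z.2 hk
    simp [h, one_act]⟩

lemma star_ext {k : ℕ} {z w : B.starSubgroup k} (h1 : z.1.1 = w.1.1)
    (h2 : k = m + 2 → z.1.2 = w.1.2) : z = w := by
  by_cases hk : k = m + 2
  · exact Subtype.ext (Prod.ext h1 (h2 hk))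
  · exact Subtype.ext (Prod.ext h1 ((z.2 hk).trans (w.2 hk).symm))

/-- The folded complex `E^*`, that is `H_n × G_n → E_{n-1} → ⋯ → E_1`. -/
def star : ReducedCrossedComplex.{u} where
  X k := B.starSubgroup k
  d k := (B.starIncl k).comp (B.starBoundary k)
  act := B.starAct
  zero_subsingleton := ⟨fun z w =>
    B.star_ext (B.E.zero_subsingleton.elim _ _) (fun h => by omega)⟩
  act_one k z := B.star_ext (by simp [starAct, B.E.act_one])
    (fun _ => by simp [starAct, H.act_one, G.act_one])
  act_mul k z a b := B.star_ext (by simp [starAct, B.E.act_mul])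
    (fun _ => by simp [starAct, H.act_mul, G.act_mul])
  mul_act k z w a := B.star_ext (by simp [starAct, B.E.mul_act])
    (fun _ => by simp [starAct, H.mul_act, G.mul_act])
  act_conj z a := B.star_ext (by simp [starAct, B.E.act_conj]) (fun h => by omega)
  mul_comm_of_three_le k hk z w := B.star_ext (B.E.mul_comm_of_three_le k hk _ _)
    (fun _ => Prod.ext (H.mul_comm_of_three_le k hk _ _) (G.mul_comm_of_three_le k hk _ _))
  d_act k z a := by
    refine B.star_ext ?_ (fun _ => ?_)
    · change B.starBoundary k _ = B.E.act k (B.starBoundary k z) a.1.1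
      by_cases hk : k = m + 1
      · subst hk
        rw [starBoundary_top, starBoundary_top, B.E.mul_act, ← B.α_act, ← B.β_act]
        rfl
      · rw [starBoundary_of_ne _ _ hk, starBoundary_of_ne _ _ hk, ← B.E.d_act]
        rfl
    · change (1 : H.X k × G.X k) = (H.act k 1 _, G.act k 1 _)
      rw [one_act, one_act]
      rfl
  d_d k z := by
    refine B.star_ext ?_ (fun _ => rfl)
    change B.starBoundary k (B.starIncl (k + 1) (B.starBoundary (k + 1) z)) = 1
    by_cases hk : k = m + 1
    · subst hk
      rw [starBoundary_top]
      change B.α 1 * B.β 1 = 1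
      simp
    · rw [starBoundary_of_ne _ _ hk]
      change B.E.d k (B.starBoundary (k + 1) z) = 1
      by_cases hk' : k = m
      · subst hk'
        rw [starBoundary_top, B.d_α_mul_β]
      · rw [starBoundary_of_ne _ _ (by omega), B.E.d_d]
  peiffer z w := by
    refine B.star_ext ?_ (fun h => ?_)
    · change B.E.act 2 w.1.1 (B.starBoundary 1 z) = z.1.1⁻¹ * w.1.1 * z.1.1
      by_cases hm : 1 = m + 1
      · have := B.subsingleton_E 2 (by omega)
        exact Subsingleton.elim _ _
      · rw [starBoundary_of_ne _ _ hm, B.E.peiffer]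
    · obtain rfl : m = 0 := by omega
      have hz : B.starBoundary 1 z = B.α z.1.2.1 * B.β z.1.2.2 := B.starBoundary_top z
      have h1 : B.p.f 1 (B.starBoundary 1 z) = H.d 1 z.1.2.1 := by
        have h2 := B.p_α z.1.2.1
        have h3 := B.p_β z.1.2.2
        exact (congrArg _ hz).trans ((map_mul _ _ _).trans ((congrArg₂ (· * ·) h2 h3).trans (mul_one _)))
      have h4 : B.f.f 1 (B.starBoundary 1 z) = G.d 1 z.1.2.2 := by
        have h2 := B.f_α z.1.2.1
        have h3 := B.f_β z.1.2.2
        exact (congrArg _ hz).trans ((map_mul _ _ _).trans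
          ((congrArg₂ (· * ·) h2 h3).trans (one_mul _)))
      refine Prod.ext ?_ ?_
      · change H.act 2 w.1.2.1 (B.p.f 1 (B.starBoundary 1 z)) = z.1.2.1⁻¹ * w.1.2.1 * z.1.2.1
        rw [h1, H.peiffer]
      · change G.act 2 w.1.2.2 (B.f.f 1 (B.starBoundary 1 z)) = z.1.2.2⁻¹ * w.1.2.2 * z.1.2.2
        rw [h4, G.peiffer]
  act_boundary k hk z w := by
    refine B.star_ext ?_ (fun h => ?_)
    · change B.E.act k w.1.1 (B.starBoundary 1 z) = w.1.1
      by_cases hm : 1 = m + 1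
      · have := B.subsingleton_E k (by omega)
        exact Subsingleton.elim _ _
      · rw [starBoundary_of_ne _ _ hm, B.E.act_boundary k hk]
    · have hz : B.starBoundary 1 z = B.E.d 1 z.1.1 := B.starBoundary_of_ne 1 (by omega) z
      refine Prod.ext ?_ ?_
      · change H.act k w.1.2.1 (B.p.f 1 (B.starBoundary 1 z)) = w.1.2.1
        rw [hz, B.p.f_d, H.act_boundary k hk]
      · change G.act k w.1.2.2 (B.f.f 1 (B.starBoundary 1 z)) = w.1.2.2
        rw [hz, B.f.f_d, G.act_boundary k hk]

lemma star_isNCrossed : B.star.IsNCrossed ((m + 2 : ℕ) : ℕ∞) := by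
  intro k hk
  have hk' : m + 2 < k := by exact_mod_cast hk
  have := B.subsingleton_E k (by omega)
  exact ⟨fun z w => B.star_ext (Subsingleton.elim _ _) (fun h => by omega)⟩

/-- The natural map `p^*` in degree `k`: in degree `n` it is the projection from `H_n × G_n` to
`H_n`, and in all other degrees it is `p`. -/
def pStarMap (k : ℕ) : B.starSubgroup k →* H.X k :=
  if k = m + 2 then
    (MonoidHom.fst _ _).comp ((MonoidHom.snd _ _).comp (B.starSubgroup k).subtype)
  else (B.p.f k).comp ((MonoidHom.fst _ _).comp (B.starSubgroup k).subtype)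

lemma pStarMap_top (z : B.starSubgroup (m + 2)) : B.pStarMap (m + 2) z = z.1.2.1 := by
  simp [pStarMap]

lemma pStarMap_of_ne (k : ℕ) (hk : k ≠ m + 2) (z : B.starSubgroup k) :
    B.pStarMap k z = B.p.f k z.1.1 := by
  simp [pStarMap, hk]

lemma pStarMap_d (k : ℕ) (z : B.starSubgroup (k + 1)) :
    B.pStarMap k (B.starIncl k (B.starBoundary k z)) = H.d k (B.pStarMap (k + 1) z) := by
  by_cases hk : k = m + 1
  · subst hk
    rw [pStarMap_of_ne _ _ (by omega), pStarMap_top]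
    change B.p.f (m + 1) (B.starBoundary (m + 1) z) = H.d (m + 1) z.1.2.1
    rw [starBoundary_top, map_mul, B.p_α, B.p_β, mul_one]
  · rw [pStarMap_of_ne _ (k + 1) (by omega)]
    by_cases hk' : k = m + 2
    · subst hk'
      rw [pStarMap_top]
      change 1 = H.d (m + 2) (B.p.f (m + 2 + 1) z.1.1)
      rw [B.E_eq_one _ (by omega) z.1.1, map_one, map_one]
    · rw [pStarMap_of_ne _ _ hk']
      change B.p.f k (B.starBoundary k z) = H.d k (B.p.f (k + 1) z.1.1)
      rw [starBoundary_of_ne _ _ hk, B.p.f_d]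

lemma pStarMap_act (k : ℕ) (z : B.starSubgroup k) (a : B.starSubgroup 1) :
    B.pStarMap k (B.starAct k z a) = H.act k (B.pStarMap k z) (B.pStarMap 1 a) := by
  rw [pStarMap_of_ne _ 1 (by omega)]
  by_cases hk : k = m + 2
  · subst hk
    rw [pStarMap_top, pStarMap_top]
    rfl
  · rw [pStarMap_of_ne _ _ hk, pStarMap_of_ne _ _ hk]
    exact B.p.f_act k z.1.1 a.1.1

/-- The natural morphism `p^*` from `E^*` to `H`. -/
def pStar : B.star ⟶ H where
  f := B.pStarMap
  f_d := B.pStarMap_d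
  f_act := B.pStarMap_act

end Butterfly

namespace ReducedCrossedComplex

/-! A morphism $\varphi:C\to D$ is a trivial fibration as soon as every map $C_{k+1}\to\ker
d_k\times_{\ker d_k}D_{k+1}$ is onto (`trivialFibrations_of_toFiberProd_surjective`): cycles lift to
cycles, and a cycle whose image bounds is itself a boundary.

For $p^*$ this criterion is a rereading of the butterfly axioms (`toFiberProd_pStar_surjective`).
Below degree $n$ it is the surjectivity of the $u_k$. In degree $n$ it comes from $\ker
u_{n-1}=\beta(G_n)$, which absorbs the difference between a cycle $e$ over $\partial_n x$ and
$\alpha(x)$. In degree $n+1$ it says that a cycle $(1,y)$ of $H_n\times G_n$ is trivial, which is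
injectivity of $\beta$. Above that everything vanishes.

Since $p^*$ is then a trivial fibration between $N$-crossed complexes, cofibrancy of $Q$ lifts $p_Q$
through it, and two-out-of-three makes the lift a weak equivalence. -/

lemma IsNCrossed.mono {M N : ℕ∞} (h : M ≤ N) {C : ReducedCrossedComplex.{u}}
    (hC : C.IsNCrossed M) : C.IsNCrossed N :=
  fun k hk => hC k (h.trans_lt hk)

lemma hom_point_ext {C : ReducedCrossedComplex.{u}} (φ ψ : point ⟶ C) : φ = ψ := by
  refine Hom.ext (funext fun k => MonoidHom.ext fun x => ?_)
  have hx : x = 1 := rfl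
  rw [hx, map_one, map_one]

lemma homotopyMap_comp {C D E : ReducedCrossedComplex.{u}} (φ : C ⟶ D) (ψ : D ⟶ E) (k : ℕ) :
    ⇑(homotopyMap (φ ≫ ψ) k) = homotopyMap ψ k ∘ homotopyMap φ k := by
  funext x
  obtain ⟨x, rfl⟩ := QuotientGroup.mk_surjective x
  rfl

lemma weakEquivalences_of_postcomp {C D E : ReducedCrossedComplex.{u}} {φ : C ⟶ D} {ψ : D ⟶ E}
    (hψ : weakEquivalences ψ) (h : weakEquivalences (φ ≫ ψ)) : weakEquivalences φ := by
  intro k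
  have hk := h k
  rw [homotopyMap_comp] at hk
  exact (Function.Bijective.of_comp_iff' (hψ k) _).mp hk

/-! ### Trivial fibrations via surjectivity onto fibre products -/

section FiberProd

variable {C D : ReducedCrossedComplex.{u}} {φ : C ⟶ D}

lemma exists_of_toFiberProd_surjective {k : ℕ} (h : Function.Surjective (toFiberProd φ k))
    {x : C.X k} (hx : x ∈ C.cycles k) {y : D.X (k + 1)} (hxy : φ.f k x = D.d k y) :
    ∃ e : C.X (k + 1), C.d k e = x ∧ φ.f (k + 1) e = y := by
  obtain ⟨e, he⟩ := h ⟨(x, y), hx, hxy⟩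
  exact ⟨e, congrArg (fun z => z.1.1) he, congrArg (fun z => z.1.2) he⟩

lemma toFiberProd_surjective_of_exists {k : ℕ}
    (h : ∀ (x : C.X k) (y : D.X (k + 1)), x ∈ C.cycles k → φ.f k x = D.d k y →
      ∃ e : C.X (k + 1), C.d k e = x ∧ φ.f (k + 1) e = y) :
    Function.Surjective (toFiberProd φ k) := by
  rintro ⟨⟨x, y⟩, hx, hxy⟩
  obtain ⟨e, h1, h2⟩ := h x y hx hxy
  exact ⟨e, Subtype.ext (Prod.ext h1 h2)⟩

/-- The pair $(1,z)$ lies in the fibre product because $z$ is a cycle, and any preimage of it has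
trivial boundary. -/
lemma exists_cycle_lift (h : ∀ k, Function.Surjective (toFiberProd φ k)) (k : ℕ)
    {z : D.X k} (hz : z ∈ D.cycles k) : ∃ x ∈ C.cycles k, φ.f k x = z := by
  match k with
  | 0 => exact ⟨1, one_mem _, D.zero_subsingleton.elim _ _⟩
  | k + 1 =>
    have hz' : D.d k z = 1 := hz
    obtain ⟨e, h1, h2⟩ := exists_of_toFiberProd_surjective (h k) (one_mem _)
      ((map_one (φ.f k)).trans hz'.symm)
    exact ⟨e, h1, h2⟩

lemma d_mem_cycles (C : ReducedCrossedComplex.{u}) (k : ℕ) (x : C.X (k + 1)) :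
    C.d k x ∈ C.cycles k := by
  match k with
  | 0 => exact Subgroup.mem_top _
  | k + 1 => exact C.d_d k x

/-- A morphism `φ : C ⟶ D` for which all the maps `C_{k+1} → ker d_k ×_{ker d_k} D_{k+1}` are
surjective is a trivial fibration. -/
lemma trivialFibrations_of_toFiberProd_surjective
    (h : ∀ k, Function.Surjective (toFiberProd φ k)) : trivialFibrations φ := by
  refine ⟨fun k => ?_, fun k => ⟨?_, ?_⟩⟩
  · match k with
    | 0 => exact fun _ => ⟨1, D.zero_subsingleton.elim _ _⟩
    | k + 1 =>
      intro y
      -- Surjectivity takes two lifts: first the cycle $dy$ to a cycle $x$, then the pair $(x,y)$.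
      obtain ⟨x, hx, hxy⟩ := exists_cycle_lift h k (d_mem_cycles D k y)
      obtain ⟨e, -, he⟩ := exists_of_toFiberProd_surjective (h k) hx hxy
      exact ⟨e, he⟩
  · refine (injective_iff_map_eq_one _).mpr fun a ha => ?_
    obtain ⟨⟨z, hz⟩, rfl⟩ := QuotientGroup.mk_surjective a
    obtain ⟨y, hy⟩ : cyclesMap φ k ⟨z, hz⟩ ∈ D.boundaries k :=
      (QuotientGroup.eq_one_iff _).mp ha
    -- Here $\varphi(z)=dy$, so $(z,y)$ is in the fibre product one degree up; its lift $e$ exhibits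
    -- $z$ as a boundary.
    obtain ⟨e, he, -⟩ := exists_of_toFiberProd_surjective (h (k + 1)) hz
      (y := y) hy.symm
    exact (QuotientGroup.eq_one_iff _).mpr ⟨e, he⟩
  · intro a
    obtain ⟨⟨z, hz⟩, rfl⟩ := QuotientGroup.mk_surjective a
    obtain ⟨x, hx, rfl⟩ := exists_cycle_lift h (k + 1) hz
    exact ⟨QuotientGroup.mk ⟨x, hx⟩, rfl⟩

end FiberProd

end ReducedCrossedComplex

/-! ### The projection from the folded complex is a trivial fibration -/

namespace Butterfly

variable {m : ℕ} {H G : ReducedCrossedComplex.{u}} (B : Butterfly m H G)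

lemma star_d_of_ne {k : ℕ} (hk : k ≠ m + 1) (z : B.star.X (k + 1)) :
    B.star.d k z = B.starIncl k (B.E.d k z.1.1) :=
  congrArg (B.starIncl k) (B.starBoundary_of_ne k hk z)

lemma star_d_top (z : B.star.X (m + 2)) :
    B.star.d (m + 1) z = B.starIncl (m + 1) (B.α z.1.2.1 * B.β z.1.2.2) :=
  congrArg (B.starIncl (m + 1)) (B.starBoundary_top z)

lemma starIncl_fst {k : ℕ} (hk : k ≠ m + 2) (z : B.star.X k) : B.starIncl k z.1.1 = z :=
  B.star_ext rfl fun h => absurd h hk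

/-- The bound on `k` is sharp: up to degree $n-1$ the boundary of $E^*$ is that of $E$, while in
degree $n$ it is $\alpha\times\beta$. -/
lemma fst_mem_cycles {k : ℕ} (hk : k ≤ m + 1) {z : B.star.X k} (hz : z ∈ B.star.cycles k) :
    z.1.1 ∈ B.E.cycles k := by
  match k with
  | 0 => exact Subgroup.mem_top _
  | k + 1 =>
    have h := (B.star_d_of_ne (by omega) z).symm.trans hz
    exact congrArg (fun w => w.1.1) h

/-- An element of `E_{n-1}` with trivial boundary and the same image in `H_{n-1}` as `α x` is a
product `α x * β y`. -/
lemma exists_α_mul_β {e : B.E.X (m + 1)} (he : B.E.d m e = 1) {x : H.X (m + 2)}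
    (hx : B.p.f (m + 1) e = H.d (m + 1) x) : ∃ y, B.α x * B.β y = e := by
  -- Both $e$ and $\alpha(x)$ are cycles over $\partial_n x$, so their quotient dies under $u_{n-1}$
  -- and exactness applies.
  have hmem : (B.α x)⁻¹ * e ∈ B.β.range := by
    rw [B.range_β, MonoidHom.mem_ker]
    refine Subtype.ext (Prod.ext ?_ ?_)
    · change B.E.d m ((B.α x)⁻¹ * e) = 1
      rw [map_mul, map_inv, B.d_α, he, inv_one, one_mul]
    · change B.p.f (m + 1) ((B.α x)⁻¹ * e) = 1
      rw [map_mul, map_inv, B.p_α, hx, inv_mul_cancel]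
  obtain ⟨y, hy⟩ := hmem
  exact ⟨y, by rw [hy, mul_inv_cancel_left]⟩

lemma toFiberProd_surjective {k : ℕ} (hk : k ≤ m) : Function.Surjective (toFiberProd B.p k) := by
  rcases hk.eq_or_lt with rfl | hk
  · exact B.u_top_surjective
  · exact B.u_surjective k hk

/-- The index `k` concerns lifting to degree `k + 1`, so with $n=m+2$ the cases `k < m + 1`, `k = m
+ 1` and `k > m + 1` are lifts to degrees below, equal to and above $n$. -/
lemma toFiberProd_pStar_surjective (hH : H.IsNCrossed ((m + 2 : ℕ) : ℕ∞)) (k : ℕ) :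
    Function.Surjective (toFiberProd B.pStar k) := by
  refine toFiberProd_surjective_of_exists fun z y hz hzy => ?_
  rcases lt_trichotomy k (m + 1) with hk | rfl | hk
  · have hzy' := (B.pStarMap_of_ne k (by omega) z).symm.trans hzy
    obtain ⟨e, h1, h2⟩ := exists_of_toFiberProd_surjective
      (B.toFiberProd_surjective (by omega)) (B.fst_mem_cycles (by omega) hz) hzy'
    refine ⟨B.starIncl (k + 1) e, ?_, (B.pStarMap_of_ne (k + 1) (by omega) _).trans h2⟩
    exact (B.star_d_of_ne (by omega) _).trans
      ((congrArg (B.starIncl k) h1).trans (B.starIncl_fst (by omega) z))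
  · have hzy' := (B.pStarMap_of_ne (m + 1) (by omega) z).symm.trans hzy
    obtain ⟨g, hg⟩ := B.exists_α_mul_β (B.fst_mem_cycles le_rfl hz) hzy'
    -- The component in $E_n=1$ carries no information, and in degree $n$ the condition defining
    -- `starSubgroup` is vacuous.
    refine ⟨⟨(1, y, g), fun h => absurd rfl h⟩, ?_, B.pStarMap_top _⟩
    exact (B.star_d_top _).trans
      ((congrArg (B.starIncl (m + 1)) hg).trans (B.starIncl_fst (by omega) z))
  · have hsub : Subsingleton (H.X (k + 1)) := hH _ (by exact_mod_cast (by omega : m + 2 < k + 1))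
    -- As $H_{k+1}=1$, it remains to see that the cycle $z$ is trivial.
    refine ⟨1, ?_, Subsingleton.elim _ _⟩
    rw [map_one]
    obtain rfl | hk : k = m + 2 ∨ m + 2 < k := by omega
    · have h1 : z.1.2.1 = 1 := by
        rw [Subsingleton.elim y 1, map_one] at hzy
        exact (B.pStarMap_top z).symm.trans hzy
      have h2 : B.α z.1.2.1 * B.β z.1.2.2 = 1 :=
        congrArg (fun w => w.1.1) ((B.star_d_top z).symm.trans hz)
      rw [h1, map_one, one_mul] at h2
      exact (B.star_ext (B.E_eq_one _ le_rfl _)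
        fun _ => Prod.ext h1 (B.β_injective (h2.trans (map_one _).symm))).symm
    · exact (B.star_isNCrossed k (by exact_mod_cast hk)).elim _ _

lemma trivialFibrations_pStar (hH : H.IsNCrossed ((m + 2 : ℕ) : ℕ∞)) :
    trivialFibrations B.pStar :=
  trivialFibrations_of_toFiberProd_surjective (B.toFiberProd_pStar_surjective hH)

end Butterfly

theorem mainTheorem6 (m : ℕ) (H G : ReducedCrossedComplex.{u})
    (hH : H.IsNCrossed ((m + 2 : ℕ) : ℕ∞)) (hG : G.IsNCrossed ((m + 2 : ℕ) : ℕ∞))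
    (B : Butterfly m H G)
    (N : ℕ∞) (hN : ((m + 2 : ℕ) : ℕ∞) ≤ N)
    (Q : ReducedCrossedComplex.{u}) (hQ : Q.IsCofibrantIn N)
    (p : Q ⟶ H) (hp : ReducedCrossedComplex.trivialFibrations p) :
    ReducedCrossedComplex.trivialFibrations B.pStar ∧
      ∃ l : Q ⟶ B.star, ReducedCrossedComplex.weakEquivalences l ∧ l ≫ B.pStar = p := by
  have hB := B.trivialFibrations_pStar hH
  refine ⟨hB, ?_⟩
  -- This is the lifting property that `sq.lift` finds by instance search; it needs $E^*$ and $H$ to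
  -- be $N$-crossed, whence $n\le N$.
  have := hQ.2 B.pStar ⟨B.star_isNCrossed.mono hN, hH.mono hN, hB⟩
  have sq : CommSq B.star.fromPoint Q.fromPoint B.pStar p := ⟨hom_point_ext _ _⟩
  have hl : sq.lift ≫ B.pStar = p := sq.fac_right
  exact ⟨sq.lift, weakEquivalences_of_postcomp hB.2 (by rw [hl]; exact hp.2), hl⟩
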